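/- Let $f\in C^1(\mathbb{R}^N,\mathbb{R}^N)$, $g\in C^1(\mathbb{R}^N,\mathbb{R}^{N\times M})$, $h\in C^1(\mathbb{R}^N,\mathbb{R})$, let $R\in\mathbb{R}^{M\times M}$ be symmetric positive definite, and assume $f(0)=0$, $h(0)=0$ and $h(x)>0$ for all $x\neq 0$. For $x\in\mathbb{R}^N$ and $\mathbf u\in L^\infty([0,\infty);\mathbb{R}^M)$ let $\mathbf x_{\mathbf u}(\cdot;x)$ be the maximal Carathéodory solution of $$\dot{\mathbf x}(t)=f(\mathbf x(t))+g(\mathbf x(t))\,\mathbf u(t),\qquad \mathbf x(0)=x,$$ and put $$J_\infty(x,\mathbf u)=\int_0^\infty h(\mathbf x_{\mathbf u}(t;x))+\langle \mathbf u(t),R\,\mathbf u(t)\rangle\,dt\in[0,\infty],$$ with $J_\infty(x,\mathbf u)=+\infty$ if the solution does not exist on all of $[0,\infty)$. The optimal value function is $$v^*(x)=\inf_{\mathbf u\in L^\infty([0,\infty);\mathbb{R}^M)}J_\infty(x,\mathbf u)\in[0,\infty].$$ Let $\Omega\subset\mathbb{R}^N$ be a domain (nonempty, open, connected) with $0\in\Omega$,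 and let $k:\Omega\times\Omega\to\mathbb{R}$ be a positive definite kernel (symmetric, with positive semidefinite Gram matrices) with reproducing kernel Hilbert space $\mathcal{H}_k(\Omega)$. Assume that every element of $\mathcal{H}_k(\Omega)$ is real-analytic on $\Omega$ and that $v^*|_\Omega\in\mathcal{H}_k(\Omega)$ (in particular, $v^*$ is finite on $\Omega$). Let $X_1\subset X_2\subset\cdots$ be finite subsets of $\Omega\setminus\{0\}$ whose union is dense in $\Omega$. For each $n$ let $\mathcal{M}_{X_n}\subset\mathcal{H}_k(\Omega)$ be the set of minimizers of $$\min_{v\in\mathcal{H}_k(\Omega)}\|v\|_{\mathcal{H}_k(\Omega)}\quad\text{subject to}\quad \begin{cases}\langle f(x),\nabla v(x)\rangle-\tfrac14\,\langle g(x)^\top\nabla v(x),\,R^{-1}g(x)^\top\nabla v(x)\rangle+h(x)=0, & x\in X_n,\\ v(x)\ge 0, & x\in X_n,\\ v(0)=0.\end{cases}$$ Then every sequence $(v_n)_{n\in\mathbb{N}}$ with $v_n\in\mathcal{M}_{X_n}$ for all $n$ satisfies $$\lim_{n\to\infty}\|v_n-v^*\|_{\mathcal{H}_k(\Omega)}=0.$$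 -/

import Mathlib

open MeasureTheory Filter Topology
open scoped ENNReal Matrix

noncomputable section

namespace OptRec

/-- `ℝ^d` with its Euclidean inner product and norm. -/
abbrev Vec (d : ℕ) : Type := EuclideanSpace ℝ (Fin d)

/-- The product `A v` of a matrix with a Euclidean vector. -/
def mulVecE {m n : ℕ} (A : Matrix (Fin m) (Fin n) ℝ) (v : Vec n) : Vec m :=
  WithLp.toLp 2 (A *ᵥ v.ofLp)

/-- `⟨x, A x⟩`, that is `‖x‖_A ^ 2` for a symmetric positive definite `A`. -/
def quadForm {d : ℕ} (A : Matrix (Fin d) (Fin d) ℝ) (x : Vec d) : ℝ :=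
  inner ℝ x (mulVecE A x)

/-- Standing conditions on the system data: `f`, `g`, `h` are continuously differentiable
(`g` entrywise), `R` is symmetric positive definite, `f 0 = 0`, `h` is positive definite. -/
structure IsSystemData {N M : ℕ} (f : Vec N → Vec N) (g : Vec N → Matrix (Fin N) (Fin M) ℝ)
    (h : Vec N → ℝ) (R : Matrix (Fin M) (Fin M) ℝ) : Prop where
  contDiff_f : ContDiff ℝ 1 f
  contDiff_g : ∀ i j, ContDiff ℝ 1 fun x => g x i j
  contDiff_h : ContDiff ℝ 1 h
  posDef_R : R.PosDef
  f_zero : f 0 = 0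
  h_zero : h 0 = 0
  h_pos : ∀ x, x ≠ 0 → 0 < h x

/-- Admissible inputs: measurable, essentially bounded functions `[0, ∞) → ℝ^M`
(represented by functions on `ℝ`, whose values at negative times are irrelevant). -/
def IsControl {M : ℕ} (u : ℝ → Vec M) : Prop :=
  MemLp u ⊤ (volume.restrict (Set.Ici (0 : ℝ)))

/-- `y` is a Carathéodory solution on `[0, ∞)` of `y' = f(y) + g(y) u`, `y(0) = x`
(integral form; the integrand is locally integrable, since `y` is continuous and `u` is
essentially bounded). Values of `y` at negative times are irrelevant. -/
def IsTrajectory {N M : ℕ} (f : Vec N → Vec N) (g : Vec N → Matrix (Fin N) (Fin M) ℝ)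
    (x : Vec N) (u : ℝ → Vec M) (y : ℝ → Vec N) : Prop :=
  ContinuousOn y (Set.Ici 0) ∧
    ∀ t : ℝ, 0 ≤ t → y t = x + ∫ s in (0 : ℝ)..t, (f (y s) + mulVecE (g (y s)) (u s))

/-- The cost `J_∞(x, u)`, with values in `[0, ∞]`. For `C^1` data a trajectory on `[0, ∞)` is
unique if it exists, so that the infimum only selects its cost; if there is none
(finite-time blow-up), the cost is `∞`. -/
def cost {N M : ℕ} (f : Vec N → Vec N) (g : Vec N → Matrix (Fin N) (Fin M) ℝ)
    (h : Vec N → ℝ) (R : Matrix (Fin M) (Fin M) ℝ) (x : Vec N) (u : ℝ → Vec M) : ℝ≥0∞ :=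
  ⨅ (y : ℝ → Vec N) (_ : IsTrajectory f g x u y),
    ∫⁻ t in Set.Ici (0 : ℝ), ENNReal.ofReal (h (y t) + quadForm R (u t))

/-- The optimal value function `v^*`, with values in `[0, ∞]`. -/
def optimalValue {N M : ℕ} (f : Vec N → Vec N) (g : Vec N → Matrix (Fin N) (Fin M) ℝ)
    (h : Vec N → ℝ) (R : Matrix (Fin M) (Fin M) ℝ) (x : Vec N) : ℝ≥0∞ :=
  ⨅ (u : ℝ → Vec M) (_ : IsControl u), cost f g h R x u

/-- Extension by zero of a function on `Ω`. On an open `Ω`, values, gradients and analyticity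
at points of `Ω` do not depend on the extension. -/
def zeroExt {N : ℕ} {Ω : Set (Vec N)} (ξ : Ω → ℝ) : Vec N → ℝ :=
  Function.extend Subtype.val ξ 0

theorem zeroExt_apply {N : ℕ} {Ω : Set (Vec N)} (ξ : Ω → ℝ) (x : Ω) :
    zeroExt ξ (x : Vec N) = ξ x :=
  Subtype.val_injective.extend_apply ξ 0 x

/-- A symmetric `k` is a positive definite kernel if its Gram matrices for pairwise distinct
points are positive semidefinite. -/
def IsPDKernel {X : Type*} (k : X → X → ℝ) : Prop :=
  (∀ x y, k x y = k y x) ∧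
    ∀ (n : ℕ) (x : Fin n → X), Function.Injective x →
      (Matrix.of fun i j => k (x i) (x j)).PosSemidef

/-- `k` is the reproducing kernel of the Hilbert function space `H` on `X`: `k x` belongs to `H`
and `⟨ξ, k x⟩ = ξ x` for all `ξ ∈ H`. -/
def IsReproducingKernel {X : Type*} (k : X → X → ℝ) (H : Type*) [NormedAddCommGroup H]
    [InnerProductSpace ℝ H] [RKHS ℝ H X ℝ] : Prop :=
  ∀ x : X, ∃ kx : H, (∀ y, kx y = k x y) ∧ ∀ ξ : H, inner ℝ ξ kx = ξ x

/-- The left-hand side of the Hamilton-Jacobi-Bellman equation at `x` for the function `v`. -/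
def hjb {N M : ℕ} (f : Vec N → Vec N) (g : Vec N → Matrix (Fin N) (Fin M) ℝ)
    (h : Vec N → ℝ) (R : Matrix (Fin M) (Fin M) ℝ) (v : Vec N → ℝ) (x : Vec N) : ℝ :=
  inner ℝ (f x) (gradient v x)
    - 1 / 4 * quadForm R⁻¹ (mulVecE (g x)ᵀ (gradient v x)) + h x

/-- The feasible set of the collocation problem with centers `X`. -/
def feasible {N M : ℕ} (f : Vec N → Vec N) (g : Vec N → Matrix (Fin N) (Fin M) ℝ)
    (h : Vec N → ℝ) (R : Matrix (Fin M) (Fin M) ℝ) {Ω : Set (Vec N)}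
    (H : Type*) [NormedAddCommGroup H] [InnerProductSpace ℝ H] [RKHS ℝ H Ω ℝ]
    (X : Finset (Vec N)) : Set H :=
  {v | (∀ x ∈ X, hjb f g h R (zeroExt v) x = 0) ∧ (∀ x ∈ X, 0 ≤ zeroExt v x) ∧
    zeroExt v 0 = 0}

/-- The set of minimizers of the `H`-norm over the feasible set with centers `X`. -/
def minimizers {N M : ℕ} (f : Vec N → Vec N) (g : Vec N → Matrix (Fin N) (Fin M) ℝ)
    (h : Vec N → ℝ) (R : Matrix (Fin M) (Fin M) ℝ) {Ω : Set (Vec N)}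
    (H : Type*) [NormedAddCommGroup H] [InnerProductSpace ℝ H] [RKHS ℝ H Ω ℝ]
    (X : Finset (Vec N)) : Set H :=
  {v | v ∈ feasible f g h R H X ∧ ∀ w ∈ feasible f g h R H X, ‖v‖ ≤ ‖w‖}

end OptRec

end

/-! The proof combines weak compactness with uniqueness for the Hamilton-Jacobi-Bellman equation.
Since `vstar` is analytic on `Ω`, dynamic programming makes it a classical solution
(`isHJBSolution_optimalValue`): short constant inputs give one inequality, nearly optimal inputs the
other.

Any two nonnegative classical solutions vanishing at 0 agree near 0 (`IsHJBSolution.eventuallyEq`).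
Along the closed loop of `v`, the difference `v - w` cannot increase, while the decay of `v` forces
the trajectory arbitrarily close to 0, where `v - w` is small. This is only local, because a closed
loop starting far from 0 might leave `Ω`; analyticity and connectedness carry the equality to all of
`Ω`.

In `tendsto_minimizers`, `vstar` is feasible for every set of centers, so the minimizers have norm
at most `‖vstar‖` and have weak limits along ultrafilters. Point evaluations and derivatives are
continuous functionals on `H`, so a weak limit satisfies the constraints on a dense set, hence
solves the equation on `Ω` and equals `vstar`. The norm bound turns weak convergence into strong
convergence. -/

noncomputable section

namespace OptRec

/-! ### Matrix algebra and completion of the square. -/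

section MatrixAlgebra

variable {l m n : ℕ}

theorem mulVecE_add (A : Matrix (Fin m) (Fin n) ℝ) (u v : Vec n) :
    mulVecE A (u + v) = mulVecE A u + mulVecE A v := by
  ext i; simp [mulVecE, Matrix.mulVec_add]

theorem mulVecE_smul (A : Matrix (Fin m) (Fin n) ℝ) (c : ℝ) (u : Vec n) :
    mulVecE A (c • u) = c • mulVecE A u := by
  ext i; simp [mulVecE, Matrix.mulVec_smul]

theorem mulVecE_zero (A : Matrix (Fin m) (Fin n) ℝ) : mulVecE A (0 : Vec n) = 0 := by
  ext i; simp [mulVecE]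

theorem mulVecE_mulVecE (A : Matrix (Fin l) (Fin m) ℝ) (B : Matrix (Fin m) (Fin n) ℝ) (u : Vec n) :
    mulVecE A (mulVecE B u) = mulVecE (A * B) u := by
  ext i; simp [mulVecE, Matrix.mulVec_mulVec]

theorem mulVecE_one (u : Vec n) : mulVecE (1 : Matrix (Fin n) (Fin n) ℝ) u = u := by
  ext i; simp [mulVecE]

theorem inner_mulVecE_left (A : Matrix (Fin m) (Fin n) ℝ) (u : Vec n) (w : Vec m) :
    inner ℝ (mulVecE A u) w = inner ℝ u (mulVecE Aᵀ w) := by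
  simp only [mulVecE, EuclideanSpace.inner_eq_star_dotProduct, star_trivial]
  rw [Matrix.dotProduct_mulVec, ← Matrix.mulVec_transpose, dotProduct_comm]

theorem quadForm_nonneg {R : Matrix (Fin m) (Fin m) ℝ} (hR : R.PosDef) (u : Vec m) :
    0 ≤ quadForm R u := by
  have := hR.posSemidef.dotProduct_mulVec_nonneg u.ofLp
  simpa [quadForm, mulVecE, EuclideanSpace.inner_eq_star_dotProduct, dotProduct_comm] using this

theorem quadForm_zero (R : Matrix (Fin m) (Fin m) ℝ) : quadForm R (0 : Vec m) = 0 := by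
  simp [quadForm]

theorem PosDef.transpose_eq {R : Matrix (Fin m) (Fin m) ℝ} (hR : R.PosDef) : Rᵀ = R := by
  simpa [Matrix.IsHermitian] using hR.isHermitian

/-- Completion of the square. -/
theorem inner_add_quadForm {R : Matrix (Fin m) (Fin m) ℝ} (hR : R.PosDef) (b u : Vec m) :
    inner ℝ u b + quadForm R u =
      quadForm R (u + (1 / 2 : ℝ) • mulVecE R⁻¹ b) - 1 / 4 * quadForm R⁻¹ b := by
  have hu : IsUnit R.det := (Matrix.isUnit_iff_isUnit_det R).1 hR.isUnit
  have h1 : mulVecE R (mulVecE R⁻¹ b) = b := by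
    rw [mulVecE_mulVecE, Matrix.mul_nonsing_inv _ hu, mulVecE_one]
  have h2 : inner ℝ (mulVecE R⁻¹ b) (mulVecE R u) = inner ℝ u b := by
    rw [real_inner_comm, inner_mulVecE_left, PosDef.transpose_eq hR, h1]
  simp only [quadForm, mulVecE_add, mulVecE_smul, inner_add_left, inner_add_right, inner_smul_left,
    inner_smul_right, h1, h2]
  rw [real_inner_comm b (mulVecE R⁻¹ b)]
  simp
  ring

theorem continuous_mulVecE {X : Type*} [TopologicalSpace X] {A : X → Matrix (Fin m) (Fin n) ℝ}
    {u : X → Vec n} (hA : ∀ i j, Continuous fun x => A x i j) (hu : Continuous u) :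
    Continuous fun x => mulVecE (A x) (u x) := by
  refine (PiLp.continuous_toLp 2 _).comp (continuous_pi fun i => ?_)
  simp only [Matrix.mulVec, dotProduct]
  refine continuous_finsetSum _ fun j _ => (hA i j).mul ?_
  exact (EuclideanSpace.proj j).continuous.comp hu

theorem contDiffOn_mulVecE {X : Type*} [NormedAddCommGroup X] [NormedSpace ℝ X] {s : Set X}
    {k : WithTop ℕ∞} {A : X → Matrix (Fin m) (Fin n) ℝ} {u : X → Vec n}
    (hA : ∀ i j, ContDiffOn ℝ k (fun x => A x i j) s) (hu : ContDiffOn ℝ k u s) :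
    ContDiffOn ℝ k (fun x => mulVecE (A x) (u x)) s := by
  refine contDiffOn_euclidean.2 fun i => ?_
  simp only [mulVecE, Matrix.mulVec, dotProduct]
  exact ContDiffOn.sum fun j _ => (hA i j).mul (contDiffOn_euclidean.1 hu j)

end MatrixAlgebra

/-! ### The minimized Hamiltonian and its feedback. -/

section Hamiltonian

variable {N M : ℕ}

/-- The controlled vector field `f x + g x u`. -/
def field (f : Vec N → Vec N) (g : Vec N → Matrix (Fin N) (Fin M) ℝ) (x : Vec N) (u : Vec M) :
    Vec N :=
  f x + mulVecE (g x) u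

/-- The minimum over `u` of `⟨f x + g x u, q⟩ + ⟨u, R u⟩`. -/
def ham (f : Vec N → Vec N) (g : Vec N → Matrix (Fin N) (Fin M) ℝ) (R : Matrix (Fin M) (Fin M) ℝ)
    (x q : Vec N) : ℝ :=
  inner ℝ (f x) q - 1 / 4 * quadForm R⁻¹ (mulVecE (g x)ᵀ q)

/-- The minimizing input for `ham`. -/
def feedback (g : Vec N → Matrix (Fin N) (Fin M) ℝ) (R : Matrix (Fin M) (Fin M) ℝ)
    (x q : Vec N) : Vec M :=
  -((1 / 2 : ℝ) • mulVecE R⁻¹ (mulVecE (g x)ᵀ q))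

variable {f : Vec N → Vec N} {g : Vec N → Matrix (Fin N) (Fin M) ℝ} {h : Vec N → ℝ}
  {R : Matrix (Fin M) (Fin M) ℝ}

theorem hjb_eq_ham (v : Vec N → ℝ) (x : Vec N) :
    hjb f g h R v x = ham f g R x (gradient v x) + h x := rfl

/-- Completion of the square with `b = g(x)ᵀ q`. The defect vanishes exactly where the feedback is
used, which yields both `ham_le` and `inner_field_feedback`. -/
theorem inner_field_add_quadForm (hR : R.PosDef) (x q : Vec N) (u : Vec M) :
    inner ℝ (field f g x u) q + quadForm R u =
      ham f g R x q + quadForm R (u - feedback g R x q) := by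
  have := inner_add_quadForm hR (mulVecE (g x)ᵀ q) u
  rw [field, inner_add_left, inner_mulVecE_left, ham, feedback, sub_neg_eq_add]
  linarith

theorem ham_le (hR : R.PosDef) (x q : Vec N) (u : Vec M) :
    ham f g R x q ≤ inner ℝ (field f g x u) q + quadForm R u := by
  rw [inner_field_add_quadForm hR]
  linarith [quadForm_nonneg hR (u - feedback g R x q)]

theorem inner_field_feedback (hR : R.PosDef) (x q : Vec N) :
    inner ℝ (field f g x (feedback g R x q)) q + quadForm R (feedback g R x q) = ham f g R x q := by
  rw [inner_field_add_quadForm hR, sub_self, quadForm_zero, add_zero]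

theorem IsSystemData.continuous_field (hd : IsSystemData f g h R) :
    Continuous fun p : Vec N × Vec M => field f g p.1 p.2 :=
  (hd.contDiff_f.continuous.comp continuous_fst).add
    (continuous_mulVecE (fun i j => (hd.contDiff_g i j).continuous.comp continuous_fst) continuous_snd)

theorem continuous_quadForm (A : Matrix (Fin M) (Fin M) ℝ) : Continuous (quadForm A) :=
  continuous_id.inner (continuous_mulVecE (fun _ _ => continuous_const) continuous_id)

theorem IsSystemData.continuous_ham (hd : IsSystemData f g h R) :
    Continuous fun p : Vec N × Vec N => ham f g R p.1 p.2 :=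
  ((hd.contDiff_f.continuous.comp continuous_fst).inner continuous_snd).sub
    (continuous_const.mul ((continuous_quadForm R⁻¹).comp (continuous_mulVecE
      (fun i j => (hd.contDiff_g j i).continuous.comp continuous_fst) continuous_snd)))

theorem IsSystemData.h_nonneg (hd : IsSystemData f g h R) (x : Vec N) : 0 ≤ h x := by
  rcases eq_or_ne x 0 with rfl | hx
  · exact hd.h_zero.ge
  · exact (hd.h_pos x hx).le

theorem IsSystemData.contDiffOn_field (hd : IsSystemData f g h R) {u : Vec N → Vec M}
    {s : Set (Vec N)} (hu : ContDiffOn ℝ 1 u s) : ContDiffOn ℝ 1 (fun x => field f g x (u x)) s :=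
  hd.contDiff_f.contDiffOn.add (contDiffOn_mulVecE (fun i j => (hd.contDiff_g i j).contDiffOn) hu)

/-- With `q` the gradient of a solution, this makes the closed-loop field `C¹`, hence locally
solvable. -/
theorem IsSystemData.contDiffOn_feedback (hd : IsSystemData f g h R) {q : Vec N → Vec N}
    {s : Set (Vec N)} (hq : ContDiffOn ℝ 1 q s) :
    ContDiffOn ℝ 1 (fun x => feedback g R x (q x)) s := by
  have h1 : ContDiffOn ℝ 1 (fun x => mulVecE (g x)ᵀ (q x)) s :=
    contDiffOn_mulVecE (fun i j => (hd.contDiff_g j i).contDiffOn) hq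
  have h2 : ContDiffOn ℝ 1 (fun x => mulVecE R⁻¹ (mulVecE (g x)ᵀ (q x))) s :=
    contDiffOn_mulVecE (fun _ _ => contDiffOn_const) h1
  exact ((contDiffOn_const (c := (1 / 2 : ℝ))).smul h2).neg

end Hamiltonian

/-! ### Exit times and ordinary differential equations with truncated fields. -/

section Curves

variable {E : Type*} [NormedAddCommGroup E]

/-- A path starting in an open ball either stays there or has a first time at which it meets
the sphere. -/
theorem exists_first_exit {y : ℝ → E} {c : E} {r T : ℝ} (hy : ContinuousOn y (Set.Icc 0 T))
    (h0 : ‖y 0 - c‖ < r) (hT : ∃ t ∈ Set.Icc 0 T, r ≤ ‖y t - c‖) :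
    ∃ τ ∈ Set.Icc 0 T, 0 < τ ∧ ‖y τ - c‖ = r ∧ ∀ t ∈ Set.Ico 0 τ, ‖y t - c‖ < r := by
  have hφ : ContinuousOn (fun t => ‖y t - c‖) (Set.Icc 0 T) := (hy.sub continuousOn_const).norm
  have hcl : IsClosed (Set.Icc 0 T ∩ (fun t => ‖y t - c‖) ⁻¹' Set.Ici r) :=
    hφ.preimage_isClosed_of_isClosed isClosed_Icc isClosed_Ici
  have hcomp : IsCompact (Set.Icc 0 T ∩ (fun t => ‖y t - c‖) ⁻¹' Set.Ici r) :=
    isCompact_Icc.of_isClosed_subset hcl Set.inter_subset_left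
  obtain ⟨t, ht, htr⟩ := hT
  obtain ⟨τ, ⟨hτ, hτr⟩, hmin⟩ := hcomp.exists_isLeast ⟨t, ht, htr⟩
  have hlt : ∀ t ∈ Set.Ico 0 τ, ‖y t - c‖ < r := fun t ht => by
    by_contra! hcon
    exact absurd (hmin ⟨⟨ht.1, ht.2.le.trans hτ.2⟩, hcon⟩) (not_le.2 ht.2)
  have hpos : 0 < τ := by
    rcases hτ.1.eq_or_lt with h | h
    · subst h; exact absurd h0 (not_lt.2 hτr)
    · exact h
  refine ⟨τ, hτ, hpos, le_antisymm ?_ hτr, hlt⟩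
  have hsub : Set.Icc 0 τ ⊆ Set.Icc 0 T := Set.Icc_subset_Icc_right hτ.2
  have hmem : τ ∈ closure (Set.Ico 0 τ) := by
    rw [closure_Ico hpos.ne]; exact ⟨hpos.le, le_rfl⟩
  have := ((hφ τ hτ).mono (Set.Ico_subset_Icc_self.trans hsub)).closure_le hmem
    (continuousWithinAt_const (b := r)) fun t ht => (hlt t ht).le
  exact this

variable [InnerProductSpace ℝ E] [FiniteDimensional ℝ E]

/-- A `C¹` vector field on a neighbourhood of a closed ball agrees there with a globally
Lipschitz and bounded one. -/
theorem exists_lipschitz_bounded_extension {F : E → E} {Ω : Set E} (hΩ : IsOpen Ω)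
    (hF : ContDiffOn ℝ 1 F Ω) {c : E} {r : ℝ} (hr : 0 < r) (hsub : Metric.closedBall c r ⊆ Ω) :
    ∃ (G : E → E) (K L : NNReal), LipschitzWith K G ∧ (∀ x, ‖G x‖ ≤ L) ∧
      Set.EqOn G F (Metric.closedBall c r) := by
  obtain ⟨δ, hδ, hδsub⟩ := (isCompact_closedBall c r).exists_cthickening_subset_open hΩ hsub
  -- The cutoff equals 1 on the given ball, and its support, the ball of radius `r + δ`, still lies
  -- in `Ω`.
  let χ : ContDiffBump c := ⟨r, r + δ, hr, by linarith⟩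
  have hχ : tsupport χ ⊆ Ω := by
    rw [χ.tsupport_eq]
    refine Set.Subset.trans ?_ hδsub
    rw [cthickening_closedBall hδ.le hr.le, add_comm]
  have hG : ContDiff ℝ 1 fun x => χ x • F x := by
    rw [contDiff_iff_contDiffAt]
    intro x
    by_cases hx : x ∈ Ω
    · exact χ.contDiff.contDiffAt.smul (hF.contDiffAt (hΩ.mem_nhds hx))
    · have : (fun x => χ x • F x) =ᶠ[𝓝 x] fun _ => 0 := by
        filter_upwards [(isClosed_tsupport χ).isOpen_compl.mem_nhds fun h => hx (hχ h)] with z hz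
        rw [image_eq_zero_of_notMem_tsupport hz, zero_smul]
      exact contDiffAt_const.congr_of_eventuallyEq this
  have hcs : HasCompactSupport fun x => χ x • F x := χ.hasCompactSupport.smul_right
  obtain ⟨K, hK⟩ := hG.lipschitzWith_of_hasCompactSupport hcs one_ne_zero
  obtain ⟨C, hC⟩ := hcs.exists_bound_of_continuous hG.continuous
  refine ⟨_, K, C.toNNReal, hK, fun x => (hC x).trans (Real.le_coe_toNNReal C), fun x hx => ?_⟩
  simp [χ.one_of_mem_closedBall hx]

/-- Solutions on arbitrarily long intervals for a bounded Lipschitz vector field. -/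
theorem exists_solution_of_bounded {G : E → E} {K L : NNReal} (hK : LipschitzWith K G)
    (hL : ∀ x, ‖G x‖ ≤ L) (x : E) {T : ℝ} (hT : 0 ≤ T) :
    ∃ y : ℝ → E, y 0 = x ∧ (∀ t ∈ Set.Icc 0 T, y t = x + ∫ s in (0 : ℝ)..t, G (y s)) ∧
      ∀ t ∈ Set.Icc 0 T, HasDerivWithinAt y (G (y t)) (Set.Icc 0 T) t := by
  let t₀ : Set.Icc (0 : ℝ) T := ⟨0, le_rfl, hT⟩
  -- A field bounded by `L` moves a point by at most `L * T` in time `T`, so with this radius one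
  -- Picard-Lindelöf step covers the whole interval.
  have hPL : IsPicardLindelof (fun _ => G) t₀ x (L * T.toNNReal) 0 L K :=
    { lipschitzOnWith := fun _ _ => hK.lipschitzOnWith
      continuousOn := fun _ _ => continuousOn_const
      norm_le := fun _ _ z _ => hL z
      mul_max_le := by simp [t₀, hT] }
  obtain ⟨z, hz0, hz⟩ := hPL.exists_eq_forall_mem_Icc_hasDerivWithinAt (x := x) (by simp)
  refine ⟨z, hz0, fun t ht => ?_, hz⟩
  have hzc : ContinuousOn z (Set.Icc 0 T) := fun t ht => (hz t ht).continuousWithinAt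
  have hsub : Set.Icc 0 t ⊆ Set.Icc 0 T := Set.Icc_subset_Icc_right ht.2
  rw [intervalIntegral.integral_eq_sub_of_hasDeriv_right_of_le ht.1 (hzc.mono hsub)
    (f' := fun s => G (z s))]
  · have : z 0 = x := hz0
    simp [this]
  · intro s hs
    exact ((hz s (hsub ⟨hs.1.le, hs.2.le⟩)).hasDerivAt
      (Icc_mem_nhds hs.1 (hs.2.trans_le ht.2))).hasDerivWithinAt
  · exact (hK.continuous.comp_continuousOn
      (hzc.mono (by rwa [Set.uIcc_of_le ht.1]))).intervalIntegrable

end Curves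

/-! ### Local uniqueness for the Hamilton-Jacobi-Bellman equation. -/

section Uniqueness

variable {N M : ℕ} {f : Vec N → Vec N} {g : Vec N → Matrix (Fin N) (Fin M) ℝ} {h : Vec N → ℝ}
  {R : Matrix (Fin M) (Fin M) ℝ} {Ω : Set (Vec N)} {v w : Vec N → ℝ}

/-- Nonnegative solutions with `C¹` gradient of the Hamilton-Jacobi-Bellman equation on `Ω` that
vanish at the origin. -/
structure IsHJBSolution (f : Vec N → Vec N) (g : Vec N → Matrix (Fin N) (Fin M) ℝ) (h : Vec N → ℝ)
    (R : Matrix (Fin M) (Fin M) ℝ) (Ω : Set (Vec N)) (v : Vec N → ℝ) : Prop where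
  differentiableAt : ∀ x ∈ Ω, DifferentiableAt ℝ v x
  contDiffOn_gradient : ContDiffOn ℝ 1 (gradient v) Ω
  nonneg : ∀ x ∈ Ω, 0 ≤ v x
  zero : v 0 = 0
  hjb_eq : ∀ x ∈ Ω, hjb f g h R v x = 0

theorem gradient_eq_zero_of_isLocalMin {x : Vec N} (hv : IsLocalMin v x) : gradient v x = 0 := by
  rw [gradient, hv.fderiv_eq_zero, map_zero]

theorem hjb_of_gradient_eq_zero {x : Vec N} (hv : gradient v x = 0) : hjb f g h R v x = h x := by
  simp [hjb, hv, mulVecE_zero, quadForm_zero]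

/-- A zero of `v` in `Ω` is an interior minimum, so the gradient vanishes there and the equation
reduces to `h x = 0`. -/
theorem IsHJBSolution.pos (hd : IsSystemData f g h R) (hΩ : IsOpen Ω)
    (hv : IsHJBSolution f g h R Ω v) {x : Vec N} (hx : x ∈ Ω) (hx0 : x ≠ 0) : 0 < v x := by
  refine (hv.nonneg x hx).lt_of_ne fun h0 => ?_
  have hmin : IsLocalMin v x := by
    filter_upwards [hΩ.mem_nhds hx] with z hz
    rw [← h0]; exact hv.nonneg z hz
  have := hv.hjb_eq x hx
  rw [hjb_of_gradient_eq_zero (gradient_eq_zero_of_isLocalMin hmin)] at this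
  exact (hd.h_pos x hx0).ne' this

theorem hasDerivWithinAt_comp_curve {y : ℝ → Vec N} {y' : Vec N} {s : Set ℝ} {t : ℝ}
    (hv : DifferentiableAt ℝ v (y t)) (hy : HasDerivWithinAt y y' s t) :
    HasDerivWithinAt (fun t => v (y t)) (inner ℝ y' (gradient v (y t))) s t := by
  have := hv.hasFDerivAt.comp_hasDerivWithinAt t hy
  rwa [← inner_gradient_left, real_inner_comm] at this

/-- Along the closed loop of a solution `v` of the Hamilton-Jacobi-Bellman equation, `v` decreases
at least at the rate `h`, and `v - w` is nonincreasing for any other solution `w`. -/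
theorem closedLoop_antitone (hd : IsSystemData f g h R) (hv : IsHJBSolution f g h R Ω v)
    (hw : IsHJBSolution f g h R Ω w) {y : ℝ → Vec N} {T : ℝ}
    (hyΩ : ∀ t ∈ Set.Icc 0 T, y t ∈ Ω)
    (hy : ∀ t ∈ Set.Icc 0 T, HasDerivWithinAt y
      (field f g (y t) (feedback g R (y t) (gradient v (y t)))) (Set.Icc 0 T) t) :
    AntitoneOn (fun t => v (y t) - w (y t)) (Set.Icc 0 T) ∧
      ∀ c : ℝ, (∀ t ∈ Set.Icc 0 T, c ≤ h (y t)) →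
        AntitoneOn (fun t => v (y t) + c * t) (Set.Icc 0 T) := by
  have hvd t (ht : t ∈ Set.Icc 0 T) :=
    hasDerivWithinAt_comp_curve (hv.differentiableAt _ (hyΩ t ht)) (hy t ht)
  have hwd t (ht : t ∈ Set.Icc 0 T) :=
    hasDerivWithinAt_comp_curve (hw.differentiableAt _ (hyΩ t ht)) (hy t ht)
  have hveq t (ht : t ∈ Set.Icc 0 T) := inner_field_feedback (f := f) (g := g) hd.posDef_R (y t)
    (gradient v (y t))
  have hwle t (ht : t ∈ Set.Icc 0 T) := ham_le (f := f) (g := g) hd.posDef_R (y t)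
    (gradient w (y t)) (feedback g R (y t) (gradient v (y t)))
  have hvj t (ht : t ∈ Set.Icc 0 T) := hv.hjb_eq _ (hyΩ t ht)
  have hwj t (ht : t ∈ Set.Icc 0 T) := hw.hjb_eq _ (hyΩ t ht)
  simp only [hjb_eq_ham] at hvj hwj
  refine ⟨antitoneOn_of_hasDerivWithinAt_nonpos (convex_Icc 0 T)
    (fun t ht => ((hvd t ht).sub (hwd t ht)).continuousWithinAt)
    (fun t ht => ((hvd t (interior_subset ht)).sub (hwd t (interior_subset ht))).mono
      interior_subset) fun t ht => ?_, fun c hc =>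
    antitoneOn_of_hasDerivWithinAt_nonpos (convex_Icc 0 T)
    (fun t ht => ((hvd t ht).add ((hasDerivWithinAt_id t _).const_mul c)).continuousWithinAt)
    (fun t ht => ((hvd t (interior_subset ht)).add ((hasDerivWithinAt_id t _).const_mul c)).mono
      interior_subset) fun t ht => ?_⟩
  -- The feedback of `v` attains the minimum in the Hamiltonian for `∇v` but is merely a competitor
  -- for `∇w`, so `v` falls at least as fast as `w`.
  · have ht := interior_subset ht
    linarith [hveq t ht, hwle t ht, hvj t ht, hwj t ht]
  · have ht := interior_subset ht
    linarith [hveq t ht, hvj t ht, hc t ht, quadForm_nonneg hd.posDef_R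
      (feedback g R (y t) (gradient v (y t)))]

/-- Closed-loop trajectories that start near the origin stay near it. -/
theorem exists_closedLoop (hd : IsSystemData f g h R) (hΩ : IsOpen Ω)
    (hv : IsHJBSolution f g h R Ω v) {r m : ℝ} (hr : 0 < r)
    (hsub : Metric.closedBall 0 r ⊆ Ω) (hm : ∀ z, ‖z‖ = r → m ≤ v z)
    {x : Vec N} (hx : ‖x‖ < r) (hxm : v x < m) {T : ℝ} (hT : 0 ≤ T) :
    ∃ y : ℝ → Vec N, y 0 = x ∧ (∀ t ∈ Set.Icc 0 T, ‖y t‖ < r) ∧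
      ∀ t ∈ Set.Icc 0 T, HasDerivWithinAt y
        (field f g (y t) (feedback g R (y t) (gradient v (y t)))) (Set.Icc 0 T) t := by
  obtain ⟨G, K, L, hK, hL, hG⟩ := exists_lipschitz_bounded_extension hΩ
    (hd.contDiffOn_field (hd.contDiffOn_feedback hv.contDiffOn_gradient)) hr hsub
  obtain ⟨y, hy0, -, hy⟩ := exists_solution_of_bounded hK hL x hT
  have hball : ∀ t ∈ Set.Icc 0 T, ‖y t‖ < r := by
    -- Up to a first exit time the truncated field is the true closed loop, so `v` has not increased
    -- and remains below `m`, whereas `v ≥ m` on the sphere.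
    by_contra! hcon
    obtain ⟨τ, hτ, hτ0, hτr, hlt⟩ := exists_first_exit (y := y) (c := 0) (r := r)
      (fun t ht => (hy t ht).continuousWithinAt) (by simpa [hy0] using hx) (by simpa using hcon)
    simp only [sub_zero] at hτr hlt
    have hle : ∀ t ∈ Set.Icc 0 τ, y t ∈ Metric.closedBall (0 : Vec N) r := fun t ht => by
      rw [mem_closedBall_zero_iff]
      rcases ht.2.eq_or_lt with rfl | h
      · exact hτr.le
      · exact (hlt t ⟨ht.1, h⟩).le
    have hyd : ∀ t ∈ Set.Icc 0 τ, HasDerivWithinAt y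
        (field f g (y t) (feedback g R (y t) (gradient v (y t)))) (Set.Icc 0 τ) t := fun t ht => by
      have := hG (hle t ht)
      simp only at this
      rw [← this]
      exact (hy t ⟨ht.1, ht.2.trans hτ.2⟩).mono (Set.Icc_subset_Icc_right hτ.2)
    have := (closedLoop_antitone hd hv hv (fun t ht => hsub (hle t ht)) hyd).2 0
      (fun t _ => hd.h_nonneg _) ⟨le_rfl, hτ0.le⟩ ⟨hτ0.le, le_rfl⟩ hτ0.le
    simp only [zero_mul, add_zero, hy0] at this
    exact absurd (hm _ hτr) (by linarith)
  refine ⟨y, hy0, hball, fun t ht => ?_⟩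
  have := hG (x := y t) (by simpa using (hball t ht).le)
  simp only at this
  rw [← this]
  exact hy t ht

theorem exists_pos_le_of_isCompact {φ : Vec N → ℝ} {s : Set (Vec N)} (hs : IsCompact s)
    (hφ : ContinuousOn φ s) (hpos : ∀ x ∈ s, 0 < φ x) : ∃ c > 0, ∀ x ∈ s, c ≤ φ x := by
  rcases s.eq_empty_or_nonempty with rfl | hne
  · exact ⟨1, one_pos, by simp⟩
  · obtain ⟨z, hz, hmin⟩ := hs.exists_isMinOn hne hφ
    exact ⟨φ z, hpos z hz, fun x hx => hmin hx⟩

/-- For each `ε`, the closed loop of `v` from `x` is followed until it enters a ball where `v - w >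
-ε`; monotonicity carries this bound back to `x`. -/
theorem IsHJBSolution.eventually_le (hd : IsSystemData f g h R) (hΩ : IsOpen Ω) (h0 : 0 ∈ Ω)
    (hv : IsHJBSolution f g h R Ω v) (hw : IsHJBSolution f g h R Ω w) :
    ∀ᶠ x in 𝓝 (0 : Vec N), w x ≤ v x := by
  obtain ⟨r, hr, hsub⟩ := Metric.nhds_basis_closedBall.mem_iff.1 (hΩ.mem_nhds h0)
  have hne {z : Vec N} {ρ : ℝ} (hρ : 0 < ρ) (hz : ρ ≤ ‖z‖) : z ≠ 0 :=
    norm_pos_iff.1 (hρ.trans_le hz)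
  obtain ⟨m, hm, hmle⟩ := exists_pos_le_of_isCompact (isCompact_sphere (0 : Vec N) r)
    (fun x hx => (hv.differentiableAt x
      (hsub (Metric.sphere_subset_closedBall hx))).continuousAt.continuousWithinAt)
    fun x hx => hv.pos hd hΩ (hsub (Metric.sphere_subset_closedBall hx))
      (hne hr (mem_sphere_zero_iff_norm.1 hx).ge)
  have hvc := (hv.differentiableAt 0 h0).continuousAt
  have hwc := (hw.differentiableAt 0 h0).continuousAt
  filter_upwards [Metric.ball_mem_nhds _ hr, hvc.eventually_lt_const (by rwa [hv.zero])]
    with x hxr hxm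
  rw [mem_ball_zero_iff] at hxr
  refine le_of_forall_pos_le_add fun ε hε => ?_
  have hdiff : ∀ᶠ z in 𝓝 (0 : Vec N), -ε < v z - w z :=
    (hvc.sub hwc).eventually_const_lt (by simp [hv.zero, hw.zero, hε])
  obtain ⟨ρ, hρ, hρε⟩ := Metric.eventually_nhds_iff.1 hdiff
  obtain ⟨c, hc, hcle⟩ := exists_pos_le_of_isCompact
    ((isCompact_closedBall (0 : Vec N) r).diff (Metric.isOpen_ball (x := (0 : Vec N)) (ε := ρ)))
    hd.contDiff_h.continuous.continuousOn fun x hx => hd.h_pos x (hne hρ (by simpa using hx.2))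
  -- If `‖y t‖ ≥ ρ` throughout, `v` would drop at rate at least `c`. Over this time it would lose `v
  -- x + c` and become negative.
  have hT : 0 ≤ v x / c + 1 := by
    have := hv.nonneg x (hsub (by simpa using hxr.le))
    positivity
  obtain ⟨y, hy0, hyr, hy⟩ := exists_closedLoop hd hΩ hv hr hsub
    (fun z hz => hmle z (by simpa using hz)) hxr hxm hT
  have hyΩ : ∀ t ∈ Set.Icc 0 (v x / c + 1), y t ∈ Ω := fun t ht =>
    hsub (by simpa using (hyr t ht).le)
  obtain ⟨hanti, hdec⟩ := closedLoop_antitone hd hv hw hyΩ hy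
  obtain ⟨t, ht, htρ⟩ : ∃ t ∈ Set.Icc 0 (v x / c + 1), ‖y t‖ < ρ := by
    by_contra! hcon
    have := hdec c (fun t ht => hcle _ ⟨by simpa using (hyr t ht).le, by simpa using hcon t ht⟩)
      ⟨le_rfl, hT⟩ ⟨hT, le_rfl⟩ hT
    simp only [hy0, mul_zero, add_zero, mul_add, mul_one, mul_div_cancel₀ _ hc.ne'] at this
    linarith [hv.nonneg _ (hyΩ _ ⟨hT, le_rfl⟩)]
  have h1 := hanti ⟨le_rfl, hT⟩ ht ht.1
  have h2 := hρε (y := y t) (by simpa using htρ)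
  simp only [hy0] at h1
  linarith

theorem IsHJBSolution.eventuallyEq (hd : IsSystemData f g h R) (hΩ : IsOpen Ω) (h0 : 0 ∈ Ω)
    (hv : IsHJBSolution f g h R Ω v) (hw : IsHJBSolution f g h R Ω w) : v =ᶠ[𝓝 0] w := by
  filter_upwards [hv.eventually_le hd hΩ h0 hw, hw.eventually_le hd hΩ h0 hv] with x h1 h2
  exact le_antisymm h2 h1

end Uniqueness

/-! ### Shifting and concatenating trajectories; splitting the cost. -/

section Trajectories

variable {N M : ℕ} {f : Vec N → Vec N} {g : Vec N → Matrix (Fin N) (Fin M) ℝ} {h : Vec N → ℝ}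
  {R : Matrix (Fin M) (Fin M) ℝ}

/-- The open half-line appears because concatenated inputs assign the switching time `T` to the
first piece; the endpoint is a null set. -/
theorem setLIntegral_comp_sub_right (F : ℝ → ℝ≥0∞) (T : ℝ) :
    ∫⁻ t in Set.Ioi T, F (t - T) = ∫⁻ t in Set.Ici (0 : ℝ), F t := by
  rw [← setLIntegral_congr (Ioi_ae_eq_Ici (a := (0 : ℝ))),
    ← (measurePreserving_sub_right volume T).setLIntegral_comp_preimage_emb
      (MeasurableEquiv.subRight T).measurableEmbedding F (Set.Ioi 0)]
  simp

theorem setLIntegral_comp_add_right (F : ℝ → ℝ≥0∞) (T : ℝ) :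
    ∫⁻ t in Set.Ici (0 : ℝ), F (t + T) = ∫⁻ t in Set.Ioi T, F t := by
  rw [← setLIntegral_comp_sub_right _ T]
  simp

theorem IsControl.comp_add_right {u : ℝ → Vec M} (hu : IsControl u) {T : ℝ} (hT : 0 ≤ T) :
    IsControl fun t => u (t + T) := by
  have h1 := (measurePreserving_add_right volume T).restrict_preimage
    (measurableSet_Ici (a := T))
  have h2 : (fun t : ℝ => t + T) ⁻¹' Set.Ici T = Set.Ici 0 := by simp
  rw [h2] at h1
  exact (hu.mono_measure (Measure.restrict_mono (Set.Ici_subset_Ici.2 hT) le_rfl)).comp_measurePreserving h1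

theorem IsControl.const_then {u : ℝ → Vec M} (hu : IsControl u) (u₀ : Vec M) (T : ℝ) :
    IsControl fun t => if t ≤ T then u₀ else u (t - T) := by
  have h1 := (measurePreserving_sub_right volume T).restrict_preimage
    (measurableSet_Ioi (a := (0 : ℝ)))
  have h2 : (fun t : ℝ => t - T) ⁻¹' Set.Ioi 0 = Set.Ioi T := by simp
  rw [h2] at h1
  have h3 : MemLp (fun t => u (t - T)) ⊤ (volume.restrict (Set.Ioi T)) :=
    (hu.mono_measure (Measure.restrict_mono Set.Ioi_subset_Ici_self le_rfl)).comp_measurePreserving h1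
  refine MemLp.piecewise (s := Set.Iic T) measurableSet_Iic (memLp_top_const u₀) ?_
  rw [Set.compl_Iic, Measure.restrict_comm measurableSet_Ioi]
  exact h3.restrict _

/-- The path has compact range and the input is essentially bounded, so almost every value of `Φ` is
taken on a compact set. -/
theorem intervalIntegrable_comp_control {E : Type*} [NormedAddCommGroup E]
    {Φ : Vec N → Vec M → E} (hΦ : Continuous fun p : Vec N × Vec M => Φ p.1 p.2)
    {y : ℝ → Vec N} {u : ℝ → Vec M} {a b : ℝ} (ha : 0 ≤ a) (hab : a ≤ b)
    (hy : ContinuousOn y (Set.Icc a b)) (hu : IsControl u) :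
    IntervalIntegrable (fun s => Φ (y s) (u s)) volume a b := by
  rw [intervalIntegrable_iff_integrableOn_Icc_of_le hab]
  have hsub : volume.restrict (Set.Icc a b) ≤ volume.restrict (Set.Ici 0) :=
    Measure.restrict_mono (fun t ht => ha.trans ht.1) le_rfl
  have hu' := hu.mono_measure hsub
  obtain ⟨C, hC⟩ : ∃ C : ℝ, ∀ᵐ s ∂volume.restrict (Set.Icc a b), ‖u s‖ ≤ C := by
    refine ⟨(eLpNormEssSup u (volume.restrict (Set.Icc a b))).toReal, ?_⟩
    filter_upwards [ae_le_eLpNormEssSup (f := u) (μ := volume.restrict (Set.Icc a b))] with s hs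
    have htop : eLpNormEssSup u (volume.restrict (Set.Icc a b)) ≠ ⊤ := by
      simpa using hu'.eLpNorm_ne_top
    simpa using ENNReal.toReal_mono htop hs
  obtain ⟨D, hD⟩ := ((isCompact_Icc.image_of_continuousOn hy).prod
    (isCompact_closedBall (0 : Vec M) C)).exists_bound_of_continuousOn hΦ.continuousOn
  refine Integrable.of_bound (hΦ.comp_aestronglyMeasurable
    ((hy.aestronglyMeasurable measurableSet_Icc).prodMk hu'.aestronglyMeasurable)) D ?_
  filter_upwards [hC, ae_restrict_mem measurableSet_Icc] with s hs hmem
  exact hD (y s, u s) ⟨Set.mem_image_of_mem _ hmem, by simpa using hs⟩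

theorem IsSystemData.continuous_runningCost (hd : IsSystemData f g h R) :
    Continuous fun p : Vec N × Vec M => h p.1 + quadForm R p.2 :=
  (hd.contDiff_h.continuous.comp continuous_fst).add
    ((continuous_quadForm R).comp continuous_snd)

theorem IsSystemData.runningCost_nonneg (hd : IsSystemData f g h R) (y : Vec N) (u : Vec M) :
    0 ≤ h y + quadForm R u :=
  add_nonneg (hd.h_nonneg y) (quadForm_nonneg hd.posDef_R u)

theorem setLIntegral_runningCost (hd : IsSystemData f g h R) {y : ℝ → Vec N} {u : ℝ → Vec M}
    {T : ℝ} (hT : 0 ≤ T) (hy : ContinuousOn y (Set.Icc 0 T)) (hu : IsControl u) :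
    ∫⁻ t in Set.Icc 0 T, ENNReal.ofReal (h (y t) + quadForm R (u t)) =
      ENNReal.ofReal (∫ t in (0 : ℝ)..T, (h (y t) + quadForm R (u t))) := by
  have hint := intervalIntegrable_comp_control (Φ := fun y u => h y + quadForm R u)
    hd.continuous_runningCost le_rfl hT hy hu
  rw [intervalIntegrable_iff_integrableOn_Icc_of_le hT] at hint
  rw [intervalIntegral.integral_of_le hT, ← integral_Icc_eq_integral_Ioc,
    ofReal_integral_eq_lintegral_ofReal hint
      (Eventually.of_forall fun t => hd.runningCost_nonneg _ _)]

theorem setLIntegral_Ici_eq_add (F : ℝ → ℝ≥0∞) {T : ℝ} (hT : 0 ≤ T) :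
    ∫⁻ t in Set.Ici (0 : ℝ), F t = (∫⁻ t in Set.Icc 0 T, F t) + ∫⁻ t in Set.Ioi T, F t := by
  rw [← lintegral_union measurableSet_Ioi, Set.Icc_union_Ioi_eq_Ici hT]
  exact Set.disjoint_left.2 fun t h1 h2 => absurd h1.2 (not_le.2 h2)

theorem optimalValue_le_of_trajectory {x : Vec N} {u : ℝ → Vec M} {y : ℝ → Vec N}
    (hu : IsControl u) (hy : IsTrajectory f g x u y) :
    optimalValue f g h R x ≤ ∫⁻ t in Set.Ici (0 : ℝ), ENNReal.ofReal (h (y t) + quadForm R (u t)) :=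
  (iInf₂_le u hu).trans (iInf₂_le y hy)

theorem IsTrajectory.comp_add_right (hd : IsSystemData f g h R) {x : Vec N} {u : ℝ → Vec M}
    {y : ℝ → Vec N} (hu : IsControl u) (hy : IsTrajectory f g x u y) {T : ℝ} (hT : 0 ≤ T) :
    IsTrajectory f g (y T) (fun t => u (t + T)) fun t => y (t + T) := by
  refine ⟨hy.1.comp (by fun_prop) fun t (ht : 0 ≤ t) => add_nonneg ht hT, fun t ht => ?_⟩
  have hint {a b : ℝ} (ha : 0 ≤ a) (hab : a ≤ b) :=
    intervalIntegrable_comp_control (Φ := field f g) hd.continuous_field ha hab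
      (hy.1.mono fun s hs => ha.trans hs.1) hu
  have h1 := intervalIntegral.integral_comp_add_right (a := 0) (b := t)
    (fun s => field f g (y s) (u s)) T
  have h2 := intervalIntegral.integral_add_adjacent_intervals (hint le_rfl hT)
    (hint hT (le_add_of_nonneg_left ht))
  simp only [field, zero_add] at h1 h2
  change y (t + T) = _
  rw [h1, hy.2 (t + T) (by positivity), hy.2 T hT, ← h2, add_assoc]

/-- Splitting the cost of a trajectory at time `T`. -/
theorem runningCost_add_optimalValue_le (hd : IsSystemData f g h R) {x : Vec N} {u : ℝ → Vec M}
    {y : ℝ → Vec N} (hu : IsControl u) (hy : IsTrajectory f g x u y) {T : ℝ} (hT : 0 ≤ T) :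
    ENNReal.ofReal (∫ t in (0 : ℝ)..T, (h (y t) + quadForm R (u t))) + optimalValue f g h R (y T) ≤
      ∫⁻ t in Set.Ici (0 : ℝ), ENNReal.ofReal (h (y t) + quadForm R (u t)) := by
  rw [setLIntegral_Ici_eq_add _ hT,
    setLIntegral_runningCost hd hT (hy.1.mono Set.Icc_subset_Ici_self) hu]
  gcongr
  refine (optimalValue_le_of_trajectory (hu.comp_add_right hT) (hy.comp_add_right hd hu hT)).trans ?_
  rw [setLIntegral_comp_add_right fun t => ENNReal.ofReal (h (y t) + quadForm R (u t))]

theorem IsTrajectory.const_then (hd : IsSystemData f g h R) {x : Vec N} {u₀ : Vec M}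
    {y : ℝ → Vec N} {T : ℝ} (hT : 0 ≤ T) (hyc : ContinuousOn y (Set.Icc 0 T))
    (hy : ∀ t ∈ Set.Icc 0 T, y t = x + ∫ s in (0 : ℝ)..t, field f g (y s) u₀)
    {u : ℝ → Vec M} {z : ℝ → Vec N} (hu : IsControl u) (hz : IsTrajectory f g (y T) u z) :
    IsTrajectory f g x (fun t => if t ≤ T then u₀ else u (t - T))
      fun t => if t ≤ T then y t else z (t - T) := by
  have hz0 : z 0 = y T := by simpa using hz.2 0 le_rfl
  have hzc : ContinuousOn (fun t => z (t - T)) (Set.Ici T) :=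
    hz.1.comp (by fun_prop) fun t (ht : T ≤ t) => sub_nonneg.2 ht
  have hcont : ContinuousOn (fun t => if t ≤ T then y t else z (t - T)) (Set.Ici 0) := by
    rw [← Set.Icc_union_Ici_eq_Ici hT]
    refine ContinuousOn.union_of_isClosed (hyc.congr fun t ht => if_pos ht.2)
      -- Both closed pieces contain `T`, where the two branches agree because `z 0 = y T`.
      (hzc.congr fun t ht => ?_) isClosed_Icc isClosed_Ici
    rcases (Set.mem_Ici.1 ht).eq_or_lt with rfl | h
    · simp [hz0]
    · exact if_neg (not_le.2 h)
  refine ⟨hcont, fun t ht => ?_⟩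
  have hint {a b : ℝ} (ha : 0 ≤ a) (hab : a ≤ b) :=
    intervalIntegrable_comp_control (Φ := field f g) hd.continuous_field ha hab
      (hcont.mono fun s hs => ha.trans hs.1) (hu.const_then u₀ T)
  have hfirst {t : ℝ} (ht : t ∈ Set.Icc 0 T) : y t = x + ∫ s in (0 : ℝ)..t,
      field f g (if s ≤ T then y s else z (s - T)) (if s ≤ T then u₀ else u (s - T)) := by
    rw [hy t ht]
    congr 1
    refine intervalIntegral.integral_congr fun s hs => ?_
    rw [Set.uIcc_of_le ht.1] at hs
    simp only [if_pos (hs.2.trans ht.2)]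
  change _ = x + ∫ s in (0 : ℝ)..t,
      field f g (if s ≤ T then y s else z (s - T)) (if s ≤ T then u₀ else u (s - T))
  rcases le_or_gt t T with htT | htT
  · simp only [if_pos htT]
    exact hfirst ⟨ht, htT⟩
  · simp only [if_neg (not_le.2 htT)]
    rw [← intervalIntegral.integral_add_adjacent_intervals (hint le_rfl hT) (hint hT htT.le),
      ← add_assoc, ← hfirst ⟨hT, le_rfl⟩, hz.2 _ (sub_nonneg.2 htT.le)]
    congr 1
    have h1 := intervalIntegral.integral_comp_sub_right (a := T) (b := t)
      (fun s => field f g (z s) (u s)) T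
    rw [sub_self] at h1
    change ∫ s in (0 : ℝ)..(t - T), field f g (z s) (u s) = _
    rw [← h1]
    refine intervalIntegral.integral_congr_ae (Eventually.of_forall fun s hs => ?_)
    rw [Set.uIoc_of_le htT.le] at hs
    simp only [if_neg (not_le.2 hs.1)]

/-- Using a constant input up to time `T` is at best optimal. -/
theorem optimalValue_le_const_then (hd : IsSystemData f g h R) {x : Vec N} {u₀ : Vec M}
    {y : ℝ → Vec N} {T : ℝ} (hT : 0 ≤ T) (hyc : ContinuousOn y (Set.Icc 0 T))
    (hy : ∀ t ∈ Set.Icc 0 T, y t = x + ∫ s in (0 : ℝ)..t, field f g (y s) u₀) :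
    optimalValue f g h R x ≤
      ENNReal.ofReal (∫ t in (0 : ℝ)..T, (h (y t) + quadForm R u₀)) +
        optimalValue f g h R (y T) := by
  conv_rhs => rw [optimalValue]
  simp only [cost, ENNReal.add_iInf]
  refine le_iInf₂ fun u hu => le_iInf₂ fun z hz => ?_
  refine (optimalValue_le_of_trajectory (hu.const_then u₀ T)
    (hz.const_then hd hT hyc hy hu)).trans ?_
  rw [setLIntegral_Ici_eq_add _ hT]
  refine add_le_add (le_of_eq ?_) (le_of_eq ?_)
  · rw [← setLIntegral_runningCost hd hT hyc (u := fun _ => u₀) (memLp_top_const u₀)]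
    refine setLIntegral_congr_fun measurableSet_Icc fun t ht => ?_
    simp only [if_pos ht.2]
  · rw [← setLIntegral_comp_sub_right _ T]
    refine setLIntegral_congr_fun measurableSet_Ioi fun t (ht : T < t) => ?_
    simp only [if_neg (not_le.2 ht)]

theorem optimalValue_zero (hd : IsSystemData f g h R) : optimalValue f g h R 0 = 0 := by
  have hu : IsControl (fun _ : ℝ => (0 : Vec M)) := memLp_top_const 0
  have hy : IsTrajectory f g 0 (fun _ : ℝ => (0 : Vec M)) fun _ => 0 :=
    ⟨continuousOn_const, fun t _ => by simp [hd.f_zero, mulVecE_zero]⟩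
  have := optimalValue_le_of_trajectory (h := h) (R := R) hu hy
  simpa [hd.h_zero, quadForm_zero] using this

end Trajectories

/-! ### The optimal value function solves the Hamilton-Jacobi-Bellman equation. -/

section DynamicProgramming

variable {N M : ℕ} {f : Vec N → Vec N} {g : Vec N → Matrix (Fin N) (Fin M) ℝ} {h : Vec N → ℝ}
  {R : Matrix (Fin M) (Fin M) ℝ} {Ω : Set (Vec N)} {φ : Vec N → ℝ}

theorem hasDerivWithinAt_nonneg_of_eventually_le {ψ : ℝ → ℝ} {d : ℝ}
    (hψ : HasDerivWithinAt ψ d (Set.Ioi 0) 0) (hle : ∀ᶠ t in 𝓝[>] 0, ψ 0 ≤ ψ t) : 0 ≤ d := by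
  rw [hasDerivWithinAt_iff_tendsto_slope' (by simp)] at hψ
  refine ge_of_tendsto hψ ?_
  filter_upwards [hle, self_mem_nhdsWithin] with t ht (htpos : 0 < t)
  rw [slope_def_field]
  exact div_nonneg (sub_nonneg.2 ht) (by linarith)

/-- Subsolution inequality for the optimal value function. -/
theorem hjb_optimalValue_nonneg (hd : IsSystemData f g h R) (hΩ : IsOpen Ω)
    (hnn : ∀ x ∈ Ω, 0 ≤ φ x)
    (hφ : ∀ x ∈ Ω, optimalValue f g h R x = ENNReal.ofReal (φ x)) {x : Vec N} (hx : x ∈ Ω)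
    (hdiff : DifferentiableAt ℝ φ x) : 0 ≤ hjb f g h R φ x := by
  -- With this minimizing input, the right derivative at 0 of `φ (y t)` plus the accumulated cost is
  -- exactly `hjb f g h R φ x`.
  set u₀ := feedback g R x (gradient φ x) with hu₀
  obtain ⟨r, hr, hsub⟩ := Metric.nhds_basis_closedBall.mem_iff.1 (hΩ.mem_nhds hx)
  obtain ⟨G, K, L, hK, hL, hG⟩ := exists_lipschitz_bounded_extension hΩ
    (hd.contDiffOn_field (contDiffOn_const (c := u₀))) hr hsub
  obtain ⟨y, hy0, hyint, hy⟩ := exists_solution_of_bounded hK hL x zero_le_one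
  have hyc : ContinuousOn y (Set.Icc 0 1) := fun t ht => (hy t ht).continuousWithinAt
  have h01 : (0 : ℝ) ∈ Set.Icc (0 : ℝ) 1 := ⟨le_rfl, zero_le_one⟩
  have hGx : G x = field f g x u₀ := hG (Metric.mem_closedBall_self hr.le)
  have hIoi : Set.Icc (0 : ℝ) 1 ∈ 𝓝[>] (0 : ℝ) := Icc_mem_nhdsGT_of_mem ⟨le_rfl, zero_lt_one⟩
  have hyIoi : HasDerivWithinAt y (field f g x u₀) (Set.Ioi 0) 0 := by
    have := (hy 0 h01).mono_of_mem_nhdsWithin hIoi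
    rwa [hy0, hGx] at this
  have hcost : ContinuousOn (fun s => h (y s) + quadForm R u₀) (Set.Icc 0 1) :=
    (hd.contDiff_h.continuous.comp_continuousOn hyc).add continuousOn_const
  have hd1 := hasDerivWithinAt_comp_curve (v := φ) (by rwa [hy0]) hyIoi
  have hd2 : HasDerivWithinAt (fun t => ∫ s in (0 : ℝ)..t, (h (y s) + quadForm R u₀))
      (h (y 0) + quadForm R u₀) (Set.Ioi 0) 0 :=
    (intervalIntegral.integral_hasDerivWithinAt_right (s := Set.Ici 0) (t := Set.Ioi 0) (by simp)
      ⟨Set.Icc 0 1, hIoi, hcost.aestronglyMeasurable measurableSet_Icc⟩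
      ((hcost 0 h01).mono_of_mem_nhdsWithin hIoi)).mono Set.Ioi_subset_Ici_self
  -- Dynamic programming: applying `u₀` for a short time and continuing optimally costs at least `φ
  -- x`.
  have hev : ∀ᶠ t in 𝓝[>] (0 : ℝ),
      φ (y 0) + (∫ s in (0 : ℝ)..0, (h (y s) + quadForm R u₀)) ≤
        φ (y t) + ∫ s in (0 : ℝ)..t, (h (y s) + quadForm R u₀) := by
    have hnear : ∀ᶠ t in 𝓝[≥] (0 : ℝ), y t ∈ Metric.closedBall x r := by
      have h1 : ContinuousWithinAt y (Set.Ici 0) 0 :=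
        (hyc 0 h01).mono_of_mem_nhdsWithin (Icc_mem_nhdsGE zero_lt_one)
      exact h1.eventually_mem (by rw [hy0]; exact Metric.closedBall_mem_nhds x hr)
    obtain ⟨b, hb, hbsub⟩ := mem_nhdsGE_iff_exists_Icc_subset.1 hnear
    filter_upwards [Icc_mem_nhdsGT_of_mem ⟨le_rfl, hb⟩, hIoi] with t htb ht1
    have hball {s : ℝ} (hs : s ∈ Set.Icc 0 t) : y s ∈ Metric.closedBall x r :=
      hbsub ⟨hs.1, hs.2.trans htb.2⟩
    have hsubt : Set.Icc 0 t ⊆ Set.Icc (0 : ℝ) 1 := Set.Icc_subset_Icc_right ht1.2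
    have hle := optimalValue_le_const_then (h := h) (R := R) (x := x) (u₀ := u₀) hd htb.1
      (hyc.mono hsubt) fun s hs => by
        rw [hyint s (hsubt hs)]
        congr 1
        refine intervalIntegral.integral_congr fun σ hσ => ?_
        rw [Set.uIcc_of_le hs.1] at hσ
        exact hG (hball ⟨hσ.1, hσ.2.trans hs.2⟩)
    have hyt := hsub (hball ⟨htb.1, le_rfl⟩)
    have hint : 0 ≤ ∫ s in (0 : ℝ)..t, (h (y s) + quadForm R u₀) :=
      intervalIntegral.integral_nonneg htb.1 fun s _ => hd.runningCost_nonneg _ _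
    rw [hφ x hx, hφ _ hyt, ← ENNReal.ofReal_add hint (hnn _ hyt),
      ENNReal.ofReal_le_ofReal_iff (add_nonneg hint (hnn _ hyt))] at hle
    rw [hy0, intervalIntegral.integral_same]
    linarith
  have := hasDerivWithinAt_nonneg_of_eventually_le (hd1.add hd2) hev
  rw [hy0] at this
  have heq := inner_field_feedback (f := f) (g := g) hd.posDef_R x (gradient φ x)
  rw [← hu₀] at heq
  rw [hjb_eq_ham]
  linarith

/-- Moving `p` by `η` against the direction of `F` absorbs a penalty `-η * ‖F‖` into the covector,
so that `ham_le` applies to the perturbed `q`. -/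
theorem exists_inner_eq_sub_norm (F p : Vec N) {η : ℝ} (hη : 0 ≤ η) :
    ∃ q, ‖q - p‖ ≤ η ∧ inner ℝ F q = inner ℝ F p - η * ‖F‖ := by
  rcases eq_or_ne F 0 with rfl | hF
  · exact ⟨p, by simpa using hη, by simp⟩
  · have hF' : ‖F‖ ≠ 0 := norm_ne_zero_iff.2 hF
    refine ⟨p - (η / ‖F‖) • F, ?_, ?_⟩
    · rw [sub_sub_cancel_left, norm_neg, norm_smul, norm_div, norm_norm, div_mul_cancel₀ _ hF',
        Real.norm_of_nonneg hη]
    · rw [inner_sub_right, inner_smul_right, real_inner_self_eq_norm_sq]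
      field_simp

/-- Inputs have no common bound, so the speed is controlled by the running cost: `ham_le` is applied
with `q` of length at most `1 / η` directed against the field, and `ham` is bounded on the resulting
compact set. -/
theorem exists_norm_field_le (hd : IsSystemData f g h R) {K : Set (Vec N)} (hK : IsCompact K)
    {η : ℝ} (hη : 0 < η) :
    ∃ C, 0 ≤ C ∧ ∀ z ∈ K, ∀ u, ‖field f g z u‖ ≤ η * (h z + quadForm R u + C) := by
  obtain ⟨C, hC⟩ := (hK.prod (isCompact_closedBall (0 : Vec N) (1 / η))).exists_bound_of_continuousOn
    hd.continuous_ham.continuousOn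
  refine ⟨max C 0, le_max_right _ _, fun z hz u => ?_⟩
  obtain ⟨q, hq, hin⟩ := exists_inner_eq_sub_norm (field f g z u) 0 (one_div_pos.2 hη).le
  have h1 := hC (z, q) ⟨hz, by simpa using hq⟩
  have h2 := ham_le (f := f) (g := g) hd.posDef_R z q u
  rw [hin, inner_zero_right, zero_sub] at h2
  have h3 := (abs_le.1 h1).1
  have h4 : 1 / η * ‖field f g z u‖ ≤ h z + quadForm R u + max C 0 := by
    linarith [le_max_left C 0, hd.h_nonneg z]
  rwa [one_div, inv_mul_le_iff₀ hη] at h4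

/-- Short nearly optimal trajectories stay close to their starting point. -/
theorem exists_uniform_time (hd : IsSystemData f g h R) (x : Vec N) {r : ℝ} (hr : 0 < r) {B : ℝ}
    (hB : 0 ≤ B) :
    ∃ T > 0, ∀ (u : ℝ → Vec M) (y : ℝ → Vec N), IsControl u → IsTrajectory f g x u y →
      (∀ t ∈ Set.Icc 0 T, ∫ s in (0 : ℝ)..t, (h (y s) + quadForm R (u s)) ≤ B) →
      ∀ t ∈ Set.Icc 0 T, ‖y t - x‖ < r := by
  -- With this `η` and duration `1 / (C + 1)`, the path length up to the exit time is at most `η *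
  -- (B + 1) = r / 2`, too short to reach the sphere.
  have hη : 0 < r / (2 * (B + 1)) := by positivity
  obtain ⟨C, hC0, hC⟩ := exists_norm_field_le hd (isCompact_closedBall x r) hη
  refine ⟨1 / (C + 1), by positivity, fun u y hu hy hB' => ?_⟩
  by_contra! hcon
  have hyc {a b : ℝ} (ha : 0 ≤ a) : ContinuousOn y (Set.Icc a b) :=
    hy.1.mono fun s hs => ha.trans hs.1
  have hy0 : y 0 = x := by simpa using hy.2 0 le_rfl
  obtain ⟨τ, hτ, hτ0, hτr, hlt⟩ := exists_first_exit (c := x) (hyc le_rfl) (by simpa [hy0]) hcon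
  have hF := intervalIntegrable_comp_control hd.continuous_field le_rfl hτ0.le (hyc le_rfl) hu
  have hL := intervalIntegrable_comp_control
    (Φ := fun y u => h y + quadForm R u) hd.continuous_runningCost le_rfl hτ0.le (hyc le_rfl) hu
  have h1 : r ≤ ∫ s in (0 : ℝ)..τ, ‖field f g (y s) (u s)‖ := by
    rw [← hτr, hy.2 τ hτ0.le, add_sub_cancel_left]
    exact intervalIntegral.norm_integral_le_integral_norm hτ0.le
  have h2 : ∫ s in (0 : ℝ)..τ, ‖field f g (y s) (u s)‖ ≤
      ∫ s in (0 : ℝ)..τ, r / (2 * (B + 1)) * (h (y s) + quadForm R (u s) + C) := by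
    refine intervalIntegral.integral_mono_on hτ0.le hF.norm
      ((hL.add intervalIntegrable_const).const_mul _) fun s hs => hC _ ?_ _
    rw [mem_closedBall_iff_norm]
    rcases hs.2.eq_or_lt with rfl | h
    · exact hτr.le
    · exact (hlt s ⟨hs.1, h⟩).le
  rw [intervalIntegral.integral_const_mul, intervalIntegral.integral_add hL intervalIntegrable_const,
    intervalIntegral.integral_const, sub_zero, smul_eq_mul] at h2
  have h3 : τ * C < 1 := by
    have := hτ.2
    rw [le_div_iff₀ (by positivity)] at this
    linarith
  have h4 := h1.trans h2
  have h5 : r / (2 * (B + 1)) * ((∫ s in (0 : ℝ)..τ, (h (y s) + quadForm R (u s))) + τ * C) ≤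
      r / (2 * (B + 1)) * (B + 1) := by
    gcongr
    exact hB' τ hτ
  have h6 : r / (2 * (B + 1)) * (B + 1) = r / 2 := by field_simp
  linarith

theorem exists_pos_lower_bound_ham (hd : IsSystemData f g h R) {x p : Vec N} {δ : ℝ}
    (hδ : δ < ham f g R x p + h x) :
    ∃ η > 0, ∀ z q, ‖z - x‖ < η → ‖q - p‖ ≤ η → δ < ham f g R z q + h z := by
  have hc : Continuous fun a : Vec N × Vec N => ham f g R a.1 a.2 + h a.1 :=
    hd.continuous_ham.add (hd.contDiff_h.continuous.comp continuous_fst)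
  have := (hc.tendsto (x, p)).eventually_const_lt hδ
  obtain ⟨η, hη, hsub⟩ := Metric.nhds_basis_closedBall.eventually_iff.1 this
  refine ⟨η, hη, fun z q hz hq => hsub (x := (z, q)) ?_⟩
  rw [mem_closedBall_iff_norm, Prod.norm_def]
  exact max_le hz.le hq

/-- Supersolution inequality for the optimal value function. -/
theorem hjb_optimalValue_nonpos (hd : IsSystemData f g h R) (hΩ : IsOpen Ω)
    (hnn : ∀ x ∈ Ω, 0 ≤ φ x)
    (hφ : ∀ x ∈ Ω, optimalValue f g h R x = ENNReal.ofReal (φ x)) {x : Vec N} (hx : x ∈ Ω)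
    (hdiff : DifferentiableAt ℝ φ x) : hjb f g h R φ x ≤ 0 := by
  by_contra! hpos
  set p := gradient φ x with hp
  -- Half the supposed positive value leaves room for the bound to persist at nearby points and
  -- covectors.
  set δ := hjb f g h R φ x / 2 with hδ
  have hδ0 : 0 < δ := by positivity
  obtain ⟨η, hη, hham⟩ := exists_pos_lower_bound_ham (f := f) (g := g) (h := h) (R := R) (x := x)
    (p := p) (δ := δ) hd (by rw [hp, ← hjb_eq_ham]; linarith)
  have hlin : ∀ᶠ z in 𝓝 x, φ x + inner ℝ (z - x) p - η * ‖z - x‖ ≤ φ z := by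
    filter_upwards [(hasGradientAt_iff_isLittleO.1 hdiff.hasGradientAt).def hη] with z hz
    rw [← hp, real_inner_comm] at hz
    linarith [(abs_le.1 hz).1]
  obtain ⟨r, hr, hball⟩ := Metric.eventually_nhds_iff_ball.1
    ((hlin.and (hΩ.mem_nhds hx)).and (Metric.ball_mem_nhds x hη))
  obtain ⟨T, hT, hstay⟩ := exists_uniform_time hd x hr (B := φ x + 1) (by linarith [hnn x hx])
  -- The bound 1 keeps the cost below the `B = φ x + 1` used for `T`; the bound `δ * T` produces the
  -- final contradiction.
  set ε := min 1 (δ * T) with hε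
  have hε0 : 0 < ε := lt_min one_pos (by positivity)
  obtain ⟨u, hu, y, hy, hlt⟩ : ∃ u, IsControl u ∧ ∃ y, IsTrajectory f g x u y ∧
      ∫⁻ t in Set.Ici (0 : ℝ), ENNReal.ofReal (h (y t) + quadForm R (u t)) <
        ENNReal.ofReal (φ x + ε) := by
    have : optimalValue f g h R x < ENNReal.ofReal (φ x + ε) := by
      rw [hφ x hx, ENNReal.ofReal_lt_ofReal_iff (by linarith [hnn x hx])]
      linarith
    simpa only [optimalValue, cost, iInf_lt_iff, exists_prop] using this
  have hJ {t : ℝ} (ht : 0 ≤ t) := (runningCost_add_optimalValue_le hd hu hy ht).trans_lt hlt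
  have hJ0 {t : ℝ} (ht : 0 ≤ t) : 0 ≤ ∫ s in (0 : ℝ)..t, (h (y s) + quadForm R (u s)) :=
    intervalIntegral.integral_nonneg ht fun s _ => hd.runningCost_nonneg _ _
  have hyr := hstay u y hu hy fun t ht => by
    have := (le_add_right le_rfl).trans_lt (hJ ht.1)
    rw [ENNReal.ofReal_lt_ofReal_iff_of_nonneg (hJ0 ht.1)] at this
    linarith [min_le_left 1 (δ * T)]
  have hyr' {t : ℝ} (ht : t ∈ Set.Icc 0 T) := hball (y t) (by simpa [dist_eq_norm] using hyr t ht)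
  obtain ⟨⟨hlinT, hyT⟩, -⟩ := hyr' ⟨hT.le, le_rfl⟩
  have hJT := hJ hT.le
  rw [hφ _ hyT, ← ENNReal.ofReal_add (hJ0 hT.le) (hnn _ hyT),
    ENNReal.ofReal_lt_ofReal_iff_of_nonneg (add_nonneg (hJ0 hT.le) (hnn _ hyT))] at hJT
  have hyc : ContinuousOn y (Set.Icc 0 T) := hy.1.mono Set.Icc_subset_Ici_self
  have hF := intervalIntegrable_comp_control hd.continuous_field le_rfl hT.le hyc hu
  have hL := intervalIntegrable_comp_control
    (Φ := fun y u => h y + quadForm R u) hd.continuous_runningCost le_rfl hT.le hyc hu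
  have hFp := intervalIntegrable_comp_control (Φ := fun y u => inner ℝ (field f g y u) p)
    (hd.continuous_field.inner continuous_const) le_rfl hT.le hyc hu
  have hyx : y T - x = ∫ s in (0 : ℝ)..T, field f g (y s) (u s) := by
    rw [hy.2 T hT.le, add_sub_cancel_left]; rfl
  have hinner : inner ℝ (y T - x) p = ∫ s in (0 : ℝ)..T, inner ℝ (field f g (y s) (u s)) p := by
    have := (innerSL ℝ p).intervalIntegral_comp_comm hF
    simp only [innerSL_apply_apply] at this
    simp only [hyx, real_inner_comm p]
    exact this.symm
  have hnorm : ‖y T - x‖ ≤ ∫ s in (0 : ℝ)..T, ‖field f g (y s) (u s)‖ := by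
    rw [hyx]
    exact intervalIntegral.norm_integral_le_integral_norm hT.le
  -- The covector `q` varies with `s`, so the linearization error is paid along the path, whatever
  -- the size of the input.
  have hlower : ∫ _ in (0 : ℝ)..T, δ ≤ ∫ s in (0 : ℝ)..T, (h (y s) + quadForm R (u s) +
      inner ℝ (field f g (y s) (u s)) p - η * ‖field f g (y s) (u s)‖) := by
    refine intervalIntegral.integral_mono_on hT.le intervalIntegrable_const
      ((hL.add hFp).sub (hF.norm.const_mul η)) fun s hs => ?_
    obtain ⟨q, hq, hin⟩ := exists_inner_eq_sub_norm (field f g (y s) (u s)) p hη.le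
    have h1 := hham (y s) q (by simpa [dist_eq_norm] using (hyr' hs).2) hq
    have h2 := ham_le (f := f) (g := g) hd.posDef_R (y s) q (u s)
    linarith
  rw [intervalIntegral.integral_sub (hL.add hFp) (hF.norm.const_mul η),
    intervalIntegral.integral_add hL hFp, intervalIntegral.integral_const_mul,
    intervalIntegral.integral_const, sub_zero, smul_eq_mul, ← hinner] at hlower
  have h3 := mul_le_mul_of_nonneg_left hnorm hη.le
  have h4 : ε ≤ δ * T := min_le_right _ _
  -- Adding `hlinT` and `hlower` gives `φ x + δ * T ≤` cost up to `T` plus `φ (y T)`, which `hJT`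
  -- puts strictly below `φ x + ε`.
  linarith

/-- Where it is smooth, the optimal value function solves the Hamilton-Jacobi-Bellman equation. -/
theorem isHJBSolution_optimalValue (hd : IsSystemData f g h R) (hΩ : IsOpen Ω) (h0 : 0 ∈ Ω)
    (hnn : ∀ x ∈ Ω, 0 ≤ φ x)
    (hφ : ∀ x ∈ Ω, optimalValue f g h R x = ENNReal.ofReal (φ x))
    (hdiff : ∀ x ∈ Ω, DifferentiableAt ℝ φ x) (hgrad : ContDiffOn ℝ 1 (gradient φ) Ω) :
    IsHJBSolution f g h R Ω φ where
  differentiableAt := hdiff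
  contDiffOn_gradient := hgrad
  nonneg := hnn
  zero := by
    have := hφ 0 h0
    rw [optimalValue_zero hd, eq_comm, ENNReal.ofReal_eq_zero] at this
    exact le_antisymm this (hnn 0 h0)
  hjb_eq x hx := le_antisymm (hjb_optimalValue_nonpos hd hΩ hnn hφ hx (hdiff x hx))
    (hjb_optimalValue_nonneg hd hΩ hnn hφ hx (hdiff x hx))

end DynamicProgramming

/-! ### Evaluation and derivative functionals; weak limits. -/

section Functionals

variable {N : ℕ} {Ω : Set (Vec N)} {H : Type*} [NormedAddCommGroup H] [InnerProductSpace ℝ H]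
  [RKHS ℝ H Ω ℝ]

theorem zeroExt_of_notMem {ξ : Ω → ℝ} {x : Vec N} (hx : x ∉ Ω) : zeroExt ξ x = 0 :=
  Function.extend_apply' _ _ _ fun ⟨a, ha⟩ => hx (ha ▸ a.2)

/-- Evaluation of the extension by zero as a continuous linear functional. -/
theorem exists_clm_eval (x : Vec N) : ∃ φ : H →L[ℝ] ℝ, ∀ ξ : H, φ ξ = zeroExt ξ x := by
  by_cases hx : x ∈ Ω
  · exact ⟨(ContinuousLinearMap.proj (R := ℝ) (φ := fun _ : Ω => ℝ) ⟨x, hx⟩).comp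
      (RKHS.coeCLM ℝ), fun ξ => (zeroExt_apply ξ ⟨x, hx⟩).symm⟩
  · exact ⟨0, fun ξ => by rw [zeroExt_of_notMem hx]; rfl⟩

/-- In a reproducing kernel Hilbert space of functions that are differentiable at `x`, directional
derivatives at `x` are continuous linear functionals. -/
theorem exists_clm_fderiv [CompleteSpace H] {x : Vec N}
    (hdiff : ∀ ξ : H, DifferentiableAt ℝ (zeroExt ξ) x) (e : Vec N) :
    ∃ φ : H →L[ℝ] ℝ, ∀ ξ : H, φ ξ = fderiv ℝ (zeroExt ξ) x e := by
  choose ev hev using exists_clm_eval (Ω := Ω) (H := H)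
  let t : ℕ → ℝ := fun n => 1 / ((n : ℝ) + 1)
  have ht : Tendsto t atTop (𝓝[≠] 0) :=
    tendsto_nhdsWithin_iff.2 ⟨tendsto_one_div_add_atTop_nhds_zero_nat,
      Eventually.of_forall fun n => by
        have : (0 : ℝ) < t n := by positivity
        exact this.ne'⟩
  let S : ℕ → H →L[ℝ] ℝ := fun n => (t n)⁻¹ • (ev (x + t n • e) - ev x)
  have hS : Tendsto (fun n ξ => S n ξ) atTop (𝓝 fun ξ : H => fderiv ℝ (zeroExt ξ) x e) := by
    refine tendsto_pi_nhds.2 fun ξ => ?_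
    have h1 := ((hdiff ξ).hasFDerivAt.hasLineDerivAt e).tendsto_slope_zero.comp ht
    simpa [S, hev, Function.comp_def] using h1
  -- By Banach-Steinhaus, the pointwise limit of the difference quotient functionals is continuous.
  exact ⟨continuousLinearMapOfTendsto S hS, fun ξ => rfl⟩

/-- Bounded families converge weakly along ultrafilters. -/
theorem exists_weak_limit [CompleteSpace H] {ι : Type*} (U : Ultrafilter ι) {v : ι → H} {C : ℝ}
    (hv : ∀ n, ‖v n‖ ≤ C) :
    ∃ w : H, ∀ φ : H →L[ℝ] ℝ, Tendsto (fun n => φ (v n)) U (𝓝 (φ w)) := by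
  let a : ι → WeakDual ℝ H := fun n => StrongDual.toWeakDual (InnerProductSpace.toDual ℝ H (v n))
  have hmem : ((U.map a : Ultrafilter (WeakDual ℝ H)) : Filter (WeakDual ℝ H)) ≤
      𝓟 (WeakDual.toStrongDual ⁻¹' Metric.closedBall (0 : StrongDual ℝ H) C) := by
    rw [Ultrafilter.coe_map, le_principal_iff, mem_map]
    refine univ_mem' fun n => ?_
    simpa [a] using hv n
  -- Banach-Alaoglu in the dual, transferred to `H` by the Riesz isomorphism.
  obtain ⟨l, -, hl⟩ := (WeakDual.isCompact_closedBall (𝕜 := ℝ) (0 : StrongDual ℝ H)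
    C).ultrafilter_le_nhds (U.map a) hmem
  refine ⟨(InnerProductSpace.toDual ℝ H).symm (WeakDual.toStrongDual l), fun φ => ?_⟩
  have h1 : Tendsto a U (𝓝 l) := hl
  have h2 := (WeakDual.eval_continuous ((InnerProductSpace.toDual ℝ H).symm φ)).continuousAt.tendsto.comp h1
  have h3 (z : H) : φ z = inner ℝ z ((InnerProductSpace.toDual ℝ H).symm φ) := by
    rw [real_inner_comm, InnerProductSpace.toDual_symm_apply]
  have h4 : φ ((InnerProductSpace.toDual ℝ H).symm (WeakDual.toStrongDual l)) =
      l ((InnerProductSpace.toDual ℝ H).symm φ) := by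
    rw [h3, InnerProductSpace.toDual_symm_apply]; rfl
  rw [h4]
  simpa only [h3] using! h2

theorem tendsto_gradient {ι : Type*} {l : Filter ι} {F : ι → Vec N → ℝ} {G : Vec N → ℝ} {x : Vec N}
    (hF : ∀ e, Tendsto (fun n => fderiv ℝ (F n) x e) l (𝓝 (fderiv ℝ G x e))) :
    Tendsto (fun n => gradient (F n) x) l (𝓝 (gradient G x)) := by
  have hcoord (K : Vec N → ℝ) (i : Fin N) :
      gradient K x i = fderiv ℝ K x (EuclideanSpace.single i 1) := by
    rw [← inner_gradient_left, EuclideanSpace.inner_single_right]; simp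
  have : Tendsto (fun n => (gradient (F n) x).ofLp) l (𝓝 (gradient G x).ofLp) :=
    tendsto_pi_nhds.2 fun i => by simpa only [hcoord] using hF (EuclideanSpace.single i 1)
  exact ((PiLp.continuous_toLp 2 _).tendsto _).comp this

end Functionals

/-! ### Convergence of the minimum-norm collocation solutions. -/

section Convergence

variable {N M : ℕ} {f : Vec N → Vec N} {g : Vec N → Matrix (Fin N) (Fin M) ℝ} {h : Vec N → ℝ}
  {R : Matrix (Fin M) (Fin M) ℝ} {Ω : Set (Vec N)}

theorem contDiffOn_gradient_of_analytic {v : Vec N → ℝ} (hΩ : IsOpen Ω)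
    (hv : AnalyticOnNhd ℝ v Ω) : ContDiffOn ℝ 1 (gradient v) Ω := by
  have h1 : ContDiffOn ℝ 1 (fderiv ℝ v) Ω := hv.fderiv.contDiffOn hΩ.uniqueDiffOn
  exact ((InnerProductSpace.toDual ℝ (Vec N)).symm.contDiff).comp_contDiffOn h1

/-- An analytic function that satisfies the collocation conditions on a dense set of
centers solves the Hamilton-Jacobi-Bellman equation. -/
theorem isHJBSolution_of_dense (hd : IsSystemData f g h R) (hΩ : IsOpen Ω) {v : Vec N → ℝ}
    (hv : AnalyticOnNhd ℝ v Ω) {S : Set (Vec N)} (hSΩ : S ⊆ Ω) (hS : Ω ⊆ closure S)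
    (hjb0 : ∀ x ∈ S, hjb f g h R v x = 0) (hnn : ∀ x ∈ S, 0 ≤ v x) (h0 : v 0 = 0) :
    IsHJBSolution f g h R Ω v := by
  have hgrad := contDiffOn_gradient_of_analytic hΩ hv
  refine ⟨fun x hx => (hv x hx).differentiableAt, hgrad, fun x hx => ?_, h0, fun x hx => ?_⟩
  · have hc : ContinuousWithinAt v S x := (hv x hx).continuousAt.continuousWithinAt
    exact ContinuousWithinAt.closure_le (hS hx) continuousWithinAt_const hc hnn
  · have hc : ContinuousWithinAt (fun x => hjb f g h R v x) S x := by
      have h1 : ContinuousWithinAt (gradient v) S x := (hgrad.continuousOn x hx).mono hSΩ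
      have h2 := (hd.continuous_ham.continuousAt (x := (x, gradient v x))).comp_continuousWithinAt
        (f := fun z => (z, gradient v z)) (continuousWithinAt_id.prodMk h1)
      exact h2.add hd.contDiff_h.continuous.continuousWithinAt
    refine le_antisymm ?_ ?_
    · exact ContinuousWithinAt.closure_le (hS hx) hc continuousWithinAt_const fun z hz => (hjb0 z hz).le
    · exact ContinuousWithinAt.closure_le (hS hx) continuousWithinAt_const hc fun z hz => (hjb0 z hz).ge

variable {H : Type*} [NormedAddCommGroup H] [InnerProductSpace ℝ H] [CompleteSpace H]
  [RKHS ℝ H Ω ℝ]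

/-- Minimum-norm collocation converges to any solution in the native space. -/
theorem tendsto_minimizers (hd : IsSystemData f g h R) (hΩ : IsOpen Ω) (hconn : IsPreconnected Ω)
    (h0 : 0 ∈ Ω) (han : ∀ ξ : H, AnalyticOnNhd ℝ (zeroExt ξ) Ω) {s : H}
    (hs : IsHJBSolution f g h R Ω (zeroExt s)) {X : ℕ → Finset (Vec N)} (hmono : Monotone X)
    (hsub : ∀ n, (X n : Set (Vec N)) ⊆ Ω)
    (hdense : Ω ⊆ closure (⋃ n, (X n : Set (Vec N)))) {v : ℕ → H}
    (hv : ∀ n, v n ∈ minimizers f g h R H (X n)) :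
    Tendsto (fun n => ‖v n - s‖) atTop (𝓝 0) := by
  have hle (n : ℕ) : ‖v n‖ ≤ ‖s‖ := (hv n).2 s
    ⟨fun x hx => hs.hjb_eq x (hsub n hx), fun x hx => hs.nonneg x (hsub n hx), hs.zero⟩
  -- Testing along ultrafilters replaces the extraction of weakly convergent subsequences.
  rw [tendsto_iff_ultrafilter]
  intro U hU
  obtain ⟨w, hw⟩ := exists_weak_limit U hle
  have heval (x : Vec N) : Tendsto (fun n => zeroExt (v n) x) U (𝓝 (zeroExt w x)) := by
    obtain ⟨φ, hφ⟩ := exists_clm_eval (Ω := Ω) (H := H) x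
    simpa only [hφ] using hw φ
  have hgrad {x : Vec N} (hx : x ∈ Ω) :
      Tendsto (fun n => gradient (zeroExt (v n)) x) U (𝓝 (gradient (zeroExt w) x)) :=
    tendsto_gradient fun e => by
      obtain ⟨φ, hφ⟩ := exists_clm_fderiv (fun ξ : H => (han ξ x hx).differentiableAt) e
      simpa only [hφ] using hw φ
  have hlarge {x : Vec N} (hx : x ∈ ⋃ n, (X n : Set (Vec N))) : ∀ᶠ n in U, x ∈ X n := by
    obtain ⟨m, hm⟩ := Set.mem_iUnion.1 hx
    exact hU ((eventually_ge_atTop m).mono fun n hn => hmono hn hm)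
  have hwsol : IsHJBSolution f g h R Ω (zeroExt w) := by
    refine isHJBSolution_of_dense hd hΩ (han w) (Set.iUnion_subset hsub) hdense
      (fun x hx => ?_) (fun x hx => ?_) ?_
    · have h1 : Tendsto (fun n => hjb f g h R (zeroExt (v n)) x) U
          (𝓝 (hjb f g h R (zeroExt w) x)) :=
        (((hd.continuous_ham.comp (Continuous.prodMk_right x)).tendsto _).comp
          (hgrad (Set.iUnion_subset hsub hx))).add_const _
      exact tendsto_nhds_unique h1 ((tendsto_congr' ((hlarge hx).mono fun n hn =>
        (hv n).1.1 x hn)).2 tendsto_const_nhds)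
    · exact ge_of_tendsto (heval x) ((hlarge hx).mono fun n hn => (hv n).1.2.1 x hn)
    · exact tendsto_nhds_unique (heval 0) (by simp only [(hv _).1.2.2, tendsto_const_nhds])
  -- Agreement near 0 spreads over the connected set `Ω` by the identity theorem for analytic
  -- functions.
  have heq : w = s := by
    have := (han w).eqOn_of_preconnected_of_eventuallyEq (han s) hconn h0
      (hwsol.eventuallyEq hd hΩ h0 hs)
    refine RKHS.ext fun x => ?_
    simpa only [zeroExt_apply] using this x.2
  subst heq
  have hinner : Tendsto (fun n => 2 * (‖w‖ ^ 2 - inner ℝ w (v n))) U (𝓝 0) := by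
    have := ((hw (innerSL ℝ w)).const_sub (‖w‖ ^ 2)).const_mul 2
    simpa using this
  -- Expanding the square and using `‖v n‖ ≤ ‖w‖` bounds it by `2 * (‖w‖ ^ 2 - ⟪w, v n⟫)`, which
  -- tends to 0 by weak convergence.
  have hsq : Tendsto (fun n => ‖v n - w‖ ^ 2) U (𝓝 0) := by
    refine squeeze_zero (fun n => by positivity) (fun n => ?_) hinner
    rw [norm_sub_sq_real, real_inner_comm]
    have := pow_le_pow_left₀ (norm_nonneg _) (hle n) 2
    linarith
  have := hsq.sqrt
  simpa using this

end Convergence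

end OptRec

end

theorem mainTheorem1 {N M : ℕ}
    (f : OptRec.Vec N → OptRec.Vec N) (g : OptRec.Vec N → Matrix (Fin N) (Fin M) ℝ)
    (h : OptRec.Vec N → ℝ) (R : Matrix (Fin M) (Fin M) ℝ)
    (hdata : OptRec.IsSystemData f g h R)
    (Ω : Set (OptRec.Vec N)) (hΩ_open : IsOpen Ω) (hΩ_conn : IsConnected Ω)
    (hΩ_zero : (0 : OptRec.Vec N) ∈ Ω)
    (k : Ω → Ω → ℝ) (hk : OptRec.IsPDKernel k)
    (H : Type*) [NormedAddCommGroup H] [InnerProductSpace ℝ H] [CompleteSpace H]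
    [RKHS ℝ H Ω ℝ] (hkH : OptRec.IsReproducingKernel k H)
    (h_analytic : ∀ ξ : H, AnalyticOnNhd ℝ (OptRec.zeroExt ξ) Ω)
    (vstar : H)
    (hvstar : ∀ x : Ω, (OptRec.optimalValue f g h R (x : OptRec.Vec N) : EReal) =
      ((vstar x : ℝ) : EReal))
    (X : ℕ → Finset (OptRec.Vec N)) (hX_mono : Monotone X)
    (hX_sub : ∀ n, (X n : Set (OptRec.Vec N)) ⊆ Ω \ {0})
    (hX_dense : Ω ⊆ closure (⋃ n, (X n : Set (OptRec.Vec N))))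
    (v : ℕ → H) (hv : ∀ n, v n ∈ OptRec.minimizers f g h R H (X n)) :
    Tendsto (fun n => ‖v n - vstar‖) atTop (𝓝 0) := by
  -- Nonnegativity of `vstar` is read off from its equality in `EReal` with a value in `[0, ∞]`.
  have hnn : ∀ x ∈ Ω, 0 ≤ OptRec.zeroExt vstar x := fun x hx => by
    have h1 : (0 : EReal) ≤ ((vstar ⟨x, hx⟩ : ℝ) : EReal) :=
      hvstar ⟨x, hx⟩ ▸ EReal.coe_ennreal_nonneg _
    rw [OptRec.zeroExt_apply vstar ⟨x, hx⟩]
    exact_mod_cast h1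
  have hval : ∀ x ∈ Ω, OptRec.optimalValue f g h R x = ENNReal.ofReal (OptRec.zeroExt vstar x) :=
    fun x hx => by
      rw [← EReal.coe_ennreal_eq_coe_ennreal_iff, hvstar ⟨x, hx⟩, EReal.coe_ennreal_ofReal,
        max_eq_left (hnn x hx), OptRec.zeroExt_apply vstar ⟨x, hx⟩]
  exact OptRec.tendsto_minimizers hdata hΩ_open hΩ_conn.isPreconnected hΩ_zero h_analytic
    (OptRec.isHJBSolution_optimalValue hdata hΩ_open hΩ_zero hnn hval
      (fun x hx => (h_analytic vstar x hx).differentiableAt)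
      (OptRec.contDiffOn_gradient_of_analytic hΩ_open (h_analytic vstar)))
    hX_mono (fun n => (hX_sub n).trans Set.sdiff_subset) hX_dense hv
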